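/- Let $(R,\mathfrak m)$ be a Noetherian commutative local ring and $M$ a finitely generated $R$-module of dimension $d$. Let $\underline x=(x_1,\ldots,x_d)$ be a system of parameters of $M$, and let $$\mathcal D:\ D_0\subset D_1\subset\cdots\subset D_t=M$$ be the dimension filtration of $M$, that is, the filtration by submodules with $\dim D_{i-1}<\dim D_i$ for $i=1,\ldots,t$, with $D_0=H^0_{\mathfrak m}(M)$, and such that $D_{i-1}$ is the largest submodule of $D_i$ of dimension less than $\dim D_i$ for $i=1,\ldots,t$. Put $d_i=\dim D_i$, where $d_0=0$ also when $D_0=0$. A sequence $(y_1,\ldots,y_s)$ of elements of $\mathfrak m$ is called a d-sequence of an $R$-module $N$ if $(y_1,\ldots,y_{i-1})N:_N y_j=(y_1,\ldots,y_{i-1})N:_N y_iy_j$ for all $1\le i\le j\le s$. Suppose that $\underline x$ is a dd-sequence of $M$, that is, for all positive integers $n_1,\ldots,n_d$ and all $i=1,\ldots,d$ the sequence $(x_1^{n_1},\ldots,x_i^{n_i})$ is a d-sequence of $M/(x_{i+1}^{n_{i+1}},\ldots,x_d^{n_d})M$. Then, for all $i=0,1,\ldots,t-1$, we have $d_i<d$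 and $$D_i=0:_M x_{d_i+1}.$$ Moreover, $\underline x$ is a good system of parameters of $M$, that is, $D_i\cap(x_{d_i+1},\ldots,x_d)M=0$ for all $i=0,1,\ldots,t-1$. -/

import Mathlib

namespace DDSeq

universe u v

section

variable (R : Type u) [CommRing R] (M : Type v) [AddCommGroup M] [Module R M]

/-- The Krull dimension of `M` as a natural number, with the convention that the zero module has
value `0` (`Module.supportDim` gives `⊥` to the zero module). Over a Noetherian local ring the
dimension of a nonzero finitely generated module is always finite, so nothing else is truncated. -/
noncomputable def dim : ℕ :=
  ((Module.supportDim R M).unbotD 0).toNat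

/-- The zeroth local cohomology module `H⁰_𝔪(M)`: the submodule of all elements of `M` that are
killed by some power of the maximal ideal. -/
def localCohomologyZero [IsLocalRing R] : Submodule R M where
  carrier := {z | ∃ n : ℕ, ∀ a ∈ IsLocalRing.maximalIdeal R ^ n, a • z = 0}
  zero_mem' := ⟨0, fun a _ => smul_zero a⟩
  add_mem' := by
    rintro y z ⟨n, hn⟩ ⟨k, hk⟩
    refine ⟨n + k, fun a ha => ?_⟩
    rw [smul_add, hn a (Ideal.pow_le_pow_right (Nat.le_add_right n k) ha),
      hk a (Ideal.pow_le_pow_right (Nat.le_add_left k n) ha), add_zero]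
  smul_mem' := by
    rintro c z ⟨n, hn⟩
    refine ⟨n, fun a ha => ?_⟩
    rw [smul_comm, hn a ha, smul_zero]

end

section

variable {R : Type u} [CommRing R] {M : Type v} [AddCommGroup M] [Module R M]

/-- A filtration `F 0 ⊂ F 1 ⊂ ⋯ ⊂ F t = M` with `dim F (i-1) < dim F i` for `i = 1, …, t`. -/
structure SatisfiesDimensionCondition {t : ℕ} (F : Fin (t + 1) → Submodule R M) : Prop where
  mono : Monotone F
  last : F (Fin.last t) = ⊤
  dim_lt : ∀ i : Fin t,
    Module.supportDim R (F i.castSucc) < Module.supportDim R (F i.succ)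

/-- `D 0 ⊂ D 1 ⊂ ⋯ ⊂ D t = M` is the dimension filtration of `M`. -/
structure IsDimensionFiltration [IsLocalRing R] {t : ℕ} (D : Fin (t + 1) → Submodule R M) : Prop
    extends SatisfiesDimensionCondition D where
  zero_eq : D 0 = localCohomologyZero R M
  isGreatest : ∀ i : Fin t,
    IsGreatest {N : Submodule R M | N ≤ D i.succ ∧
      Module.supportDim R N < Module.supportDim R (D i.succ)} (D i.castSucc)

/-- `x = (x 0, …, x (d-1))` is a system of parameters of `M`: there are `dim M` elements, they lie
in the maximal ideal, and `M / xM` has finite length. -/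
structure IsSystemOfParameters [IsLocalRing R] (M : Type v) [AddCommGroup M] [Module R M]
    {d : ℕ} (x : Fin d → R) : Prop where
  dim_eq : dim R M = d
  mem_maximalIdeal : ∀ i, x i ∈ IsLocalRing.maximalIdeal R
  finite_length : IsFiniteLength R (M ⧸ (Ideal.span (Set.range x) • (⊤ : Submodule R M)))

/-- `x` is a good system of parameters of `M` with respect to the filtration `F`:
`F i ∩ (x_{d_i+1}, …, x_d) M = 0` for all `i < t`, where `d_i = dim F i`. As `x` is indexed from
`0`, the elements `x_{d_i+1}, …, x_d` are the `x j` with `d_i ≤ j`. -/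
structure IsGoodSystemOfParameters [IsLocalRing R] {t : ℕ} (F : Fin (t + 1) → Submodule R M)
    {d : ℕ} (x : Fin d → R) : Prop extends IsSystemOfParameters M x where
  inf_eq_bot : ∀ i : Fin t,
    F i.castSucc ⊓
      (Ideal.span (x '' {j : Fin d | dim R (F i.castSucc) ≤ (j : ℕ)}) • (⊤ : Submodule R M)) = ⊥

/-- The submodule `N :_M a = {z ∈ M | a z ∈ N}`. -/
def colon (N : Submodule R M) (a : R) : Submodule R M :=
  N.comap (LinearMap.lsmul R M a)

/-- `y` is a d-sequence of `M`: its elements lie in the maximal ideal, and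
`(y_1, …, y_{i-1}) M : y_j = (y_1, …, y_{i-1}) M : y_i y_j` for all `i ≤ j`. -/
structure IsDSequence [IsLocalRing R] (M : Type v) [AddCommGroup M] [Module R M]
    {s : ℕ} (y : Fin s → R) : Prop where
  mem_maximalIdeal : ∀ i, y i ∈ IsLocalRing.maximalIdeal R
  colon_eq : ∀ i j : Fin s, i ≤ j →
    colon (Ideal.span (y '' Set.Iio i) • (⊤ : Submodule R M)) (y j) =
      colon (Ideal.span (y '' Set.Iio i) • (⊤ : Submodule R M)) (y i * y j)

/-- `x` is a dd-sequence of `M`: for all positive exponents `n` and all `i = 1, …, s`, the sequence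
`(x_1^{n_1}, …, x_i^{n_i})` is a d-sequence of `M / (x_{i+1}^{n_{i+1}}, …, x_s^{n_s}) M`. -/
def IsDDSequence [IsLocalRing R] (M : Type v) [AddCommGroup M] [Module R M]
    {s : ℕ} (x : Fin s → R) : Prop :=
  ∀ n : Fin s → ℕ, (∀ k, 0 < n k) → ∀ (i : ℕ) (_ : 1 ≤ i) (hi : i ≤ s),
    IsDSequence
      (M ⧸ (Ideal.span ((fun k : Fin s => x k ^ n k) '' {k : Fin s | i ≤ (k : ℕ)}) •
        (⊤ : Submodule R M)))
      (fun k : Fin i => x (Fin.castLE hi k) ^ n (Fin.castLE hi k))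

end

end DDSeq

/-! Write `x k` for the parameter with index `k` counted from `0`. Both inclusions in `D i = 0 :_M x
k`, where `k = dim D i`, are dimension counts. The submodule `0 :_M x k` is killed by every `x j`
with `j ≥ k`, so `x 0, …, x (k - 1)` cut its support down to the closed point and its dimension is
at most `k` (`supportDim_torsionBy_le`). Maximality in the filtration then puts it inside `D i`.
Conversely, any submodule of dimension at most `k` is killed by `x k`
(`le_torsionBy_of_supportDim_le`). This is proved modulo powers of the later parameters, by
induction on the number of remaining ones: multiplying by the last remaining parameter makes that
parameter regular, so the dimension drops by one modulo its powers, and the colon relations undo the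
multiplication. Goodness reduces to `(0 :_M x k) ∩ (x k, x (k + 1), …) M = 0`. Throughout, exponents
are sent to infinity and Krull's intersection theorem discards the unwanted generators. -/

namespace DDSeq

open IsLocalRing

/-! ### Colon relations for dd-sequences. -/

section

variable {R : Type*} [CommRing R] {M : Type*} [AddCommGroup M] [Module R M]

/-- The ideal generated by the powers `x k ^ n k` with `k ∈ S`. -/
def powIdeal {d : ℕ} (x : Fin d → R) (n : Fin d → ℕ) (S : Set (Fin d)) : Ideal R :=
  Ideal.span ((fun k => x k ^ n k) '' S)

theorem powIdeal_mono {d : ℕ} (x : Fin d → R) (n : Fin d → ℕ) {S T : Set (Fin d)} (h : S ⊆ T) :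
    powIdeal x n S ≤ powIdeal x n T :=
  Ideal.span_mono (Set.image_mono h)

theorem powIdeal_length_le_eq_bot {d : ℕ} (x : Fin d → R) (n : Fin d → ℕ) :
    powIdeal x n {k | d ≤ (k : ℕ)} = ⊥ := by
  have : {k : Fin d | d ≤ (k : ℕ)} = ∅ := by
    ext k
    simp
  rw [powIdeal, this, Set.image_empty, Ideal.span_empty]

theorem powIdeal_congr {d : ℕ} (x : Fin d → R) {n n' : Fin d → ℕ} {S : Set (Fin d)}
    (h : ∀ k ∈ S, n k = n' k) : powIdeal x n S = powIdeal x n' S := by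
  unfold powIdeal
  congr 1
  exact Set.image_congr fun k hk => by simp only [h k hk]

theorem powIdeal_le_sup [IsLocalRing R] {d : ℕ} {x : Fin d → R}
    (hx : ∀ i, x i ∈ maximalIdeal R) {n n' : Fin d → ℕ} {S T : Set (Fin d)} (m : ℕ)
    (h : ∀ k ∈ S, (k ∈ T ∧ n' k = n k) ∨ m ≤ n' k) :
    powIdeal x n' S ≤ powIdeal x n T ⊔ maximalIdeal R ^ m := by
  rw [powIdeal, Ideal.span_le]
  rintro _ ⟨k, hk, rfl⟩
  rcases h k hk with ⟨hT, he⟩ | hm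
  · refine Ideal.mem_sup_left (Ideal.subset_span ⟨k, hT, ?_⟩)
    simp only [he]
  · exact Ideal.mem_sup_right (Ideal.pow_le_pow_right hm (Ideal.pow_mem_pow (hx k) _))

theorem mk_mem_smul_top_iff (I J : Ideal R) (z : M) :
    (Submodule.Quotient.mk z : M ⧸ (J • (⊤ : Submodule R M))) ∈
      (I • ⊤ : Submodule R (M ⧸ (J • (⊤ : Submodule R M)))) ↔
    z ∈ ((I ⊔ J) • ⊤ : Submodule R M) := by
  have h : (I • ⊤ : Submodule R (M ⧸ (J • (⊤ : Submodule R M)))) =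
      (I • ⊤ : Submodule R M).map (J • (⊤ : Submodule R M)).mkQ := by
    rw [Submodule.map_smul'', Submodule.map_top, Submodule.range_mkQ]
  rw [h, ← Submodule.mkQ_apply, ← Submodule.mem_comap, Submodule.comap_map_mkQ,
    Submodule.sup_smul, sup_comm]

/-- Krull's intersection theorem in `M / JM`. -/
theorem mem_smul_top_of_forall_pow [IsLocalRing R] [IsNoetherianRing R] [Module.Finite R M]
    (J : Ideal R) (z : M)
    (h : ∀ m : ℕ, 0 < m → z ∈ ((J ⊔ maximalIdeal R ^ m) • ⊤ : Submodule R M)) :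
    z ∈ (J • ⊤ : Submodule R M) := by
  rw [← Submodule.Quotient.mk_eq_zero, ← Submodule.mem_bot R,
    ← Ideal.iInf_pow_smul_eq_bot_of_isLocalRing (M := M ⧸ (J • (⊤ : Submodule R M)))
      (maximalIdeal R) (Ideal.IsPrime.ne_top'), Submodule.mem_iInf]
  intro m
  rcases Nat.eq_zero_or_pos m with rfl | hm
  · simp
  · rw [mk_mem_smul_top_iff, sup_comm]
    exact h m hm

/-- The d-sequence relation lifted from the quotient to `M`: the generators before `a` and those
from `i` on merge into one ideal. -/
theorem IsDDSequence.pow_smul_mem [IsLocalRing R] {d : ℕ} {x : Fin d → R}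
    (h : IsDDSequence M x) {n : Fin d → ℕ} (hn : ∀ k, 0 < n k) {i : ℕ} (hi : i ≤ d)
    {a b : Fin d} (hab : a ≤ b) (hb : (b : ℕ) < i) {z : M}
    (hz : (x a ^ n a * x b ^ n b) • z ∈
      (powIdeal x n {k | k < a ∨ i ≤ (k : ℕ)} • ⊤ : Submodule R M)) :
    x b ^ n b • z ∈ (powIdeal x n {k | k < a ∨ i ≤ (k : ℕ)} • ⊤ : Submodule R M) := by
  have hab' : (a : ℕ) ≤ b := hab
  have hc := (h n hn i (by omega) hi).colon_eq ⟨a, by omega⟩ ⟨b, hb⟩ hab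
  have hI : Ideal.span ((fun k : Fin i => x (Fin.castLE hi k) ^ n (Fin.castLE hi k)) ''
      Set.Iio ⟨a, by omega⟩) ⊔ powIdeal x n {k | i ≤ (k : ℕ)} =
      powIdeal x n {k | k < a ∨ i ≤ (k : ℕ)} := by
    unfold powIdeal
    rw [← Ideal.span_union]
    congr 1
    ext r
    constructor
    · rintro (⟨k, hk, rfl⟩ | ⟨k, hk, rfl⟩)
      · exact ⟨Fin.castLE hi k, Or.inl hk, rfl⟩
      · exact ⟨k, Or.inr hk, rfl⟩
    · rintro ⟨k, hk | hk, rfl⟩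
      · have hk' : (k : ℕ) < a := hk
        exact Or.inl ⟨⟨k, by omega⟩, hk', rfl⟩
      · exact Or.inr ⟨k, hk, rfl⟩
  have key : ∀ c : R, c • z ∈ (powIdeal x n {k | k < a ∨ i ≤ (k : ℕ)} • ⊤ : Submodule R M) ↔
      (Submodule.Quotient.mk z : M ⧸ (powIdeal x n {k | i ≤ (k : ℕ)} • (⊤ : Submodule R M))) ∈
        colon (Ideal.span ((fun k : Fin i => x (Fin.castLE hi k) ^ n (Fin.castLE hi k)) ''
      Set.Iio ⟨a, by omega⟩) • ⊤) c := by
    intro c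
    rw [← hI, ← mk_mem_smul_top_iff]
    rfl
  rw [key] at hz ⊢
  exact hc.ge hz

variable [IsLocalRing R] [IsNoetherianRing R] [Module.Finite R M]

/-- The defining relation holds modulo the generators before `a` as well; raising these to
arbitrarily high powers removes them. -/
theorem IsDDSequence.smul_mem_of_mul_smul_mem {d : ℕ} {x : Fin d → R}
    (h : IsDDSequence M x) (hx : ∀ i, x i ∈ maximalIdeal R)
    {n : Fin d → ℕ} (hn : ∀ k, 0 < n k) {i : ℕ} (hi : i ≤ d)
    {a b : Fin d} (hab : a ≤ b) (hb : (b : ℕ) < i) {z : M}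
    (hz : (x a * x b) • z ∈ (powIdeal x n {k | i ≤ (k : ℕ)} • ⊤ : Submodule R M)) :
    x b • z ∈ (powIdeal x n {k | i ≤ (k : ℕ)} • ⊤ : Submodule R M) := by
  refine mem_smul_top_of_forall_pow _ _ fun m hm => ?_
  have hab' : (a : ℕ) ≤ b := hab
  -- Exponent `m` pushes the unwanted generators into `𝔪 ^ m`, exponent `1` keeps `x a` and `x b`
  -- themselves, and `n` keeps the given ideal.
  let n' : Fin d → ℕ := fun k => if k < a then m else if (k : ℕ) < i then 1 else n k
  have hn' : ∀ k, 0 < n' k := by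
    intro k
    have := hn k
    simp only [n']
    split_ifs <;> omega
  have ha1 : n' a = 1 := by
    have : (a : ℕ) < i := by omega
    simp [n', this]
  have hb1 : n' b = 1 := by simp [n', hb, not_lt.2 hab]
  have hge : ∀ k : Fin d, i ≤ (k : ℕ) → n' k = n k := by
    intro k hk
    have h1 : ¬ k < a := by
      rw [Fin.lt_def]; omega
    simp [n', h1, not_lt.2 hk]
  have hle : powIdeal x n {k | i ≤ (k : ℕ)} ≤ powIdeal x n' {k | k < a ∨ i ≤ (k : ℕ)} := by
    rw [powIdeal_congr x (n := n) (n' := n') (S := {k : Fin d | i ≤ (k : ℕ)})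
      fun k hk => (hge k hk).symm]
    exact powIdeal_mono x n' fun k hk => Or.inr hk
  have h1 := h.pow_smul_mem hn' hi hab hb (z := z)
    (by rw [ha1, hb1, pow_one, pow_one]; exact Submodule.smul_mono_left hle hz)
  rw [hb1, pow_one] at h1
  refine Submodule.smul_mono_left (powIdeal_le_sup hx m ?_) h1
  rintro k (hk | hk)
  · exact Or.inr (by simp [n', hk])
  · exact Or.inl ⟨hk, hge k hk⟩

theorem IsDDSequence.smul_mem_of_smul_mem {d : ℕ} {x : Fin d → R}
    (h : IsDDSequence M x) (hx : ∀ i, x i ∈ maximalIdeal R)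
    {n : Fin d → ℕ} (hn : ∀ k, 0 < n k) {i : ℕ} (hi : i ≤ d)
    {a b : Fin d} (hab : a ≤ b) (hb : (b : ℕ) < i) {z : M}
    (hz : x a • z ∈ (powIdeal x n {k | i ≤ (k : ℕ)} • ⊤ : Submodule R M)) :
    x b • z ∈ (powIdeal x n {k | i ≤ (k : ℕ)} • ⊤ : Submodule R M) := by
  refine h.smul_mem_of_mul_smul_mem hx hn hi hab hb ?_
  rw [mul_comm, mul_smul]
  exact Submodule.smul_mem _ _ hz

/-- `0 :_M x a ⊆ 0 :_M x b` for `a ≤ b`. -/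
theorem IsDDSequence.smul_eq_zero_of_le {d : ℕ} {x : Fin d → R}
    (h : IsDDSequence M x) (hx : ∀ i, x i ∈ maximalIdeal R)
    {a b : Fin d} (hab : a ≤ b) {z : M} (hz : x a • z = 0) : x b • z = 0 := by
  have := h.smul_mem_of_smul_mem hx (n := fun _ => 1) (fun _ => one_pos) le_rfl hab b.2 (z := z)
    (by rw [hz]; exact Submodule.zero_mem _)
  simpa [powIdeal_length_le_eq_bot] using this

/-- `(0 :_M x a) ∩ (x a, x (a + 1), …) M = 0`. -/
theorem IsDDSequence.eq_zero_of_smul_eq_zero_of_mem {d : ℕ} {x : Fin d → R}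
    (h : IsDDSequence M x) (hx : ∀ i, x i ∈ maximalIdeal R)
    {a : Fin d} {z : M} (hz : x a • z = 0)
    (hmem : z ∈ (Ideal.span (x '' {k | a ≤ k}) • ⊤ : Submodule R M)) : z = 0 := by
  suffices hs : z ∈ ((⊥ : Ideal R) • ⊤ : Submodule R M) by simpa using hs
  refine mem_smul_top_of_forall_pow _ _ fun m hm => ?_
  let n' : Fin d → ℕ := fun k => if k < a then m else 1
  have hn' : ∀ k, 0 < n' k := by
    intro k
    simp only [n']
    split_ifs <;> omega
  have hge : ∀ k, a ≤ k → n' k = 1 := fun k hk => by simp [n', not_lt.2 hk]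
  have hset : ∀ b : Fin d, {k : Fin d | k < b ∨ d ≤ (k : ℕ)} = {k : Fin d | (k : ℕ) < b} := by
    intro b
    ext k
    simp
  -- Generators are peeled off from the top. If `z = y + x b • w` with `y` in the smaller submodule,
  -- then `x b • z = 0` puts `x b ^ 2 • w` there, hence also `x b • w` by the d-sequence relation,
  -- hence `z`.
  have descend : ∀ j : ℕ, (a : ℕ) ≤ j → j ≤ d →
      z ∈ (powIdeal x n' {k | (k : ℕ) < j} • ⊤ : Submodule R M) →
      z ∈ (powIdeal x n' {k | (k : ℕ) < a} • ⊤ : Submodule R M) := by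
    intro j haj
    induction j, haj using Nat.le_induction with
    | base => exact fun _ h => h
    | succ j haj ih =>
      intro hjd hzj
      refine ih (by omega) ?_
      let b : Fin d := ⟨j, by omega⟩
      have hab : a ≤ b := haj
      have hdec : powIdeal x n' {k | (k : ℕ) < j + 1} =
          powIdeal x n' {k | (k : ℕ) < j} ⊔ Ideal.span {x b} := by
        have : {k : Fin d | (k : ℕ) < j + 1} = {k : Fin d | (k : ℕ) < j} ∪ {b} := by
          ext k
          simp only [Set.mem_ofPred_eq, Set.mem_union, Set.mem_singleton_iff, Fin.ext_iff, b]
          omega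
        rw [powIdeal, this, Set.image_union, Ideal.span_union, Set.image_singleton, hge b hab,
          pow_one]
        rfl
      rw [hdec, Submodule.sup_smul, Submodule.mem_sup] at hzj
      obtain ⟨y, hy, w', hw', hyw⟩ := hzj
      rw [Submodule.ideal_span_singleton_smul] at hw'
      obtain ⟨w, -, rfl⟩ := hw'
      change y + x b • w = z at hyw
      have hbz := h.smul_eq_zero_of_le hx hab hz
      have hw : (x b * x b) • w ∈ (powIdeal x n' {k | (k : ℕ) < j} • ⊤ : Submodule R M) := by
        have : (x b * x b) • w = - (x b • y) := by
          rw [← hyw, smul_add, ← mul_smul] at hbz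
          exact eq_neg_of_add_eq_zero_right hbz
        rw [this]
        exact Submodule.neg_mem _ (Submodule.smul_mem _ _ hy)
      have := h.pow_smul_mem hn' le_rfl (le_refl b) b.2 (z := w)
        (by rw [hset, hge b hab, pow_one]; exact hw)
      rw [hset, hge b hab, pow_one] at this
      rw [← hyw]
      exact Submodule.add_mem _ hy this
  have hfull : z ∈ (powIdeal x n' {k | (k : ℕ) < d} • ⊤ : Submodule R M) := by
    refine Submodule.smul_mono_left (Ideal.span_le.2 ?_) hmem
    rintro _ ⟨k, hk, rfl⟩
    exact Ideal.subset_span ⟨k, k.2, by simp only [hge k hk, pow_one]⟩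
  refine Submodule.smul_mono_left ?_ (descend d a.2.le le_rfl hfull)
  rw [← powIdeal_length_le_eq_bot x n']
  refine powIdeal_le_sup hx m fun k hk => Or.inr ?_
  have : k < a := hk
  simp [n', this]

end

end DDSeq

/-! ### Dimension of submodules and annihilation by parameters. -/

namespace DDSeq

open IsLocalRing Pointwise

section

variable {R : Type*} [CommRing R] {M : Type*} [AddCommGroup M] [Module R M]

theorem supportDim_mono {N N' : Submodule R M} (h : N ≤ N') :
    Module.supportDim R N ≤ Module.supportDim R N' :=
  Module.supportDim_le_of_injective (Submodule.inclusion h) (Submodule.inclusion_injective h)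

theorem supportDim_submodule_le (N : Submodule R M) :
    Module.supportDim R N ≤ Module.supportDim R M :=
  Module.supportDim_le_of_injective N.subtype N.subtype_injective

theorem supportDim_map_le {M' : Type*} [AddCommGroup M'] [Module R M'] (f : M →ₗ[R] M')
    (N : Submodule R M) : Module.supportDim R (N.map f) ≤ Module.supportDim R N :=
  Module.supportDim_le_of_surjective (f.submoduleMap N) (f.submoduleMap_surjective N)

theorem supportDim_le_of_surjective_of_smul_eq_zero {M' : Type*} [AddCommGroup M'] [Module R M']
    (f : M →ₗ[R] M') (hf : Function.Surjective f) {r : R} (hr : ∀ z : M', r • z = 0) :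
    Module.supportDim R M' ≤ Module.supportDim R (QuotSMulTop r M) := by
  have hle : r • (⊤ : Submodule R M) ≤ LinearMap.ker f := by
    rintro _ ⟨w, -, rfl⟩
    change f (r • w) = 0
    rw [map_smul, hr]
  refine Module.supportDim_le_of_surjective ((r • (⊤ : Submodule R M)).liftQ f hle) ?_
  rw [← LinearMap.range_eq_top, Submodule.range_liftQ, LinearMap.range_eq_top]
  exact hf

variable [IsLocalRing R]

theorem support_subset_of_supportDim_le_zero (h : Module.supportDim R M ≤ 0) :
    Module.support R M ⊆ PrimeSpectrum.zeroLocus (maximalIdeal R) := by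
  rcases subsingleton_or_nontrivial M with hM | hM
  · rw [Module.support_eq_empty]
    exact Set.empty_subset _
  · refine (support_of_supportDim_eq_zero R M (le_antisymm h ?_)).le
    exact Order.krullDim_nonneg_iff.2 (Module.nonempty_support_of_nontrivial.to_subtype)

theorem supportDim_le_zero_of_support_subset
    (h : Module.support R M ⊆ PrimeSpectrum.zeroLocus (maximalIdeal R)) :
    Module.supportDim R M ≤ 0 := by
  rw [PrimeSpectrum.zeroLocus_eq_singleton] at h
  have : Subsingleton (Module.support R M) :=
    ⟨fun p q => Subtype.ext ((h p.2).trans (h q.2).symm)⟩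
  exact Order.krullDim_nonpos_of_subsingleton

theorem support_subset_of_isFiniteLength (h : IsFiniteLength R M) :
    Module.support R M ⊆ PrimeSpectrum.zeroLocus (maximalIdeal R) := by
  induction h with
  | of_subsingleton => simp [Module.support_eq_empty]
  | @of_simple_quotient M _ _ N _ _ ih =>
    rw [Module.support_of_exact (LinearMap.exact_subtype_mkQ N) N.subtype_injective
      N.mkQ_surjective]
    refine Set.union_subset ih fun p hp => ?_
    have hmax := IsSimpleModule.annihilator_isMaximal (R := R) (M := M ⧸ N)
    rw [PrimeSpectrum.mem_zeroLocus, SetLike.coe_subset_coe, ← IsLocalRing.eq_maximalIdeal hmax]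
    exact Module.annihilator_le_of_mem_support hp

variable [IsNoetherianRing R] [Module.Finite R M]

omit [Module.Finite R M] in
theorem supportDim_ne_top : Module.supportDim R M ≠ ⊤ :=
  ((Module.supportDim_le_ringKrullDim R M).trans_lt ringKrullDim_lt_top).ne

omit [Module.Finite R M] in
theorem supportDim_eq_dim [Nontrivial M] : Module.supportDim R M = dim R M := by
  have h1 := Module.supportDim_ne_bot_of_nontrivial R M
  have h2 := supportDim_ne_top (R := R) (M := M)
  unfold dim
  generalize Module.supportDim R M = s at h1 h2 ⊢
  induction s with
  | bot => exact absurd rfl h1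
  | coe s =>
    have : s ≠ ⊤ := fun h => h2 (by rw [h]; rfl)
    lift s to ℕ using this
    rfl

omit [Module.Finite R M] in
theorem supportDim_le_dim : Module.supportDim R M ≤ dim R M := by
  rcases subsingleton_or_nontrivial M with hM | hM
  · rw [Module.supportDim_eq_bot_of_subsingleton]
    exact bot_le
  · exact supportDim_eq_dim.le

/-- The radical of the annihilator of `N` contains `𝔪`, which is finitely generated, so one power of
`𝔪` kills `N`. -/
theorem le_localCohomologyZero {N : Submodule R M} (h : Module.supportDim R N ≤ 0) :
    N ≤ localCohomologyZero R M := by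
  have h1 := support_subset_of_supportDim_le_zero h
  rw [Module.support_eq_zeroLocus, PrimeSpectrum.zeroLocus_subset_zeroLocus_iff] at h1
  obtain ⟨n, hn⟩ := Ideal.exists_pow_le_of_le_radical_of_fg h1 (IsNoetherian.noetherian _)
  intro z hz
  refine ⟨n, fun a ha => ?_⟩
  exact congrArg Subtype.val (Module.mem_annihilator.1 (hn ha) ⟨z, hz⟩)

/-- If `x 0, …, x (k - 1)` cut the support of `M` down to the closed point, then `dim M ≤ k`. -/
theorem supportDim_le_of_support_inter_subset {R : Type*} [CommRing R] [IsLocalRing R]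
    [IsNoetherianRing R] (k : ℕ) : ∀ {M : Type*} [AddCommGroup M] [Module R M] [Module.Finite R M]
    (y : Fin k → R), (∀ i, y i ∈ maximalIdeal R) →
    Module.support R M ∩ PrimeSpectrum.zeroLocus (Set.range y) ⊆
      PrimeSpectrum.zeroLocus (maximalIdeal R) → Module.supportDim R M ≤ k := by
  induction k with
  | zero =>
    intro M _ _ _ y _ h
    refine supportDim_le_zero_of_support_subset fun p hp => h ⟨hp, ?_⟩
    rw [PrimeSpectrum.mem_zeroLocus, Set.range_eq_empty]
    exact Set.empty_subset _
  | succ k ih =>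
    intro M _ _ _ y hy h
    have h1 := ih (M := QuotSMulTop (y (Fin.last k)) M) (fun i => y i.castSucc)
      (fun i => hy _) (by
        rintro p ⟨hp, hp'⟩
        rw [Module.support_quotSMulTop] at hp
        refine h ⟨hp.1, ?_⟩
        rintro _ ⟨i, rfl⟩
        induction i using Fin.lastCases with
        | last => exact hp.2 rfl
        | cast i => exact hp' ⟨i, rfl⟩)
    refine (Module.supportDim_le_supportDim_quotSMulTop_succ (hy (Fin.last k))).trans ?_
    push_cast
    exact add_le_add_left h1 1

theorem IsDDSequence.supportDim_torsionBy_le {d : ℕ} {x : Fin d → R} (h : IsDDSequence M x)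
    (hx : IsSystemOfParameters M x) (k : Fin d) :
    Module.supportDim R (Submodule.torsionBy R M (x k)) ≤ (k : ℕ) := by
  refine supportDim_le_of_support_inter_subset (k : ℕ) (fun i => x (Fin.castLE k.2.le i))
    (fun i => hx.mem_maximalIdeal _) ?_
  rintro p ⟨hp, hp'⟩
  refine support_subset_of_isFiniteLength hx.finite_length ?_
  rw [Module.support_quotient]
  refine ⟨Module.support_subset_of_injective _ (Submodule.subtype_injective _) hp, ?_⟩
  rw [PrimeSpectrum.zeroLocus_span]
  rintro _ ⟨j, rfl⟩
  rcases lt_or_ge j k with hj | hj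
  · exact hp' ⟨⟨j, hj⟩, rfl⟩
  · refine Module.annihilator_le_of_mem_support hp (Module.mem_annihilator.2 fun z => ?_)
    refine Subtype.ext (h.smul_eq_zero_of_le hx.mem_maximalIdeal hj ?_)
    exact (Submodule.mem_torsionBy_iff _ _).1 z.2

/-- A dd-sequence element `x k` maps a submodule into `(x i ^ n i, …) M` as soon as the dimension of
its image modulo `(x i ^ n i, …) M` is at most `k < i`. -/
theorem IsDDSequence.smul_mem_of_supportDim_le {d : ℕ} {x : Fin d → R} (h : IsDDSequence M x)
    (hx : ∀ i, x i ∈ maximalIdeal R) (i : ℕ) : ∀ (_ : i ≤ d) {n : Fin d → ℕ}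
    (_ : ∀ k, 0 < n k) (N : Submodule R M) (k : Fin d) (_ : (k : ℕ) < i)
    (_ : Module.supportDim R (N.map (powIdeal x n {l | i ≤ (l : ℕ)} • (⊤ : Submodule R M)).mkQ) ≤
      (k : ℕ)) {z : M} (_ : z ∈ N),
    x k • z ∈ (powIdeal x n {l | i ≤ (l : ℕ)} • ⊤ : Submodule R M) := by
  induction i with
  | zero => exact fun _ _ _ _ k hk => absurd hk (Nat.not_lt_zero _)
  | succ i ih =>
    intro hi n hn N k hk hdim z hz
    let b : Fin d := ⟨i, hi⟩
    set Q : Submodule R M := powIdeal x n {l | i + 1 ≤ (l : ℕ)} • ⊤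
    -- `Q' m` adds `x b ^ m` to the generators of `Q`; by `hKrull` below, the intersection of the
    -- `Q' m` over `m > 0` is `Q`.
    let n' : ℕ → Fin d → ℕ := fun m => Function.update n b m
    let Q' : ℕ → Submodule R M := fun m => powIdeal x (n' m) {l | i ≤ (l : ℕ)} • ⊤
    have hn' : ∀ m, 0 < m → ∀ k, 0 < n' m k := by
      intro m hm k
      simp only [n', Function.update_apply]
      split_ifs
      exacts [hm, hn k]
    have hge : ∀ m, ∀ l : Fin d, i + 1 ≤ (l : ℕ) → n' m l = n l := by
      intro m l hl
      have : l ≠ b := by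
        intro hlb
        rw [hlb] at hl
        simp [b] at hl
      simp [n', this]
    have hQQ' : ∀ m, Q ≤ Q' m := by
      intro m
      refine Submodule.smul_mono_left ?_
      rw [powIdeal_congr x (n := n) (n' := n' m) (S := {l : Fin d | i + 1 ≤ (l : ℕ)})
        fun l hl => (hge m l hl).symm]
      refine powIdeal_mono _ _ fun l hl => ?_
      have : i + 1 ≤ (l : ℕ) := hl
      exact (by omega : i ≤ (l : ℕ))
    have hfac : ∀ m, (Submodule.factor (hQQ' m)).comp Q.mkQ = (Q' m).mkQ := fun m =>
      Submodule.factor_comp_mk _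
    have hKrull : ∀ w : M, (∀ m, 0 < m → w ∈ Q' m) → w ∈ Q := by
      intro w hw
      refine mem_smul_top_of_forall_pow _ _ fun m hm => ?_
      refine Submodule.smul_mono_left (powIdeal_le_sup hx m fun l hl => ?_) (hw m hm)
      have hl' : i ≤ (l : ℕ) := hl
      rcases hl'.eq_or_lt with hl' | hl'
      · have : l = b := Fin.ext hl'.symm
        right
        simp [n', this]
      · exact Or.inl ⟨hl', hge m l hl'⟩
    rcases (Nat.lt_succ_iff.1 hk).lt_or_eq with hki | hki
    · refine hKrull _ fun m hm => ih (by omega) (hn' m hm) N k hki ?_ hz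
      refine le_trans ?_ hdim
      change Module.supportDim R (N.map (Q' m).mkQ) ≤ _
      rw [← hfac m, Submodule.map_comp]
      exact supportDim_map_le _ _
    · have hkb : k = b := Fin.ext hki
      subst hkb
      -- Passing to `x b • N` kills the `x b`-torsion modulo `Q`, because there `x b ^ 2` and `x b`
      -- have the same annihilator.
      let N' : Submodule R M := N.map (LinearMap.lsmul R M (x b))
      have hN' : N' ≤ N := by
        rintro _ ⟨w, hw, rfl⟩
        exact N.smul_mem _ hw
      have hreg : IsSMulRegular (N'.map Q.mkQ) (x b) := by
        refine (isSMulRegular_iff_right_eq_zero_of_smul (R := R) (M := N'.map Q.mkQ)).2 ?_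
        rintro ⟨_, ⟨_, ⟨w, hw, rfl⟩, rfl⟩⟩ h0
        have h1 : Q.mkQ (x b • x b • w) = 0 := congrArg Subtype.val h0
        refine Subtype.ext ?_
        change Q.mkQ (x b • w) = 0
        rw [Submodule.mkQ_apply, Submodule.Quotient.mk_eq_zero] at h1 ⊢
        rw [← mul_smul] at h1
        exact h.smul_mem_of_mul_smul_mem hx hn hi le_rfl hk h1
      have hdim' : ∀ m, 0 < m →
          Module.supportDim R (N'.map (Q' m).mkQ) + 1 ≤ (i : ℕ) := by
        intro m hm
        refine le_trans ?_ ((supportDim_mono (Submodule.map_mono hN')).trans hdim)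
        rw [← Module.supportDim_quotSMulTop_succ_eq_supportDim (hreg.pow m)
          (Ideal.pow_mem_of_mem _ (hx b) m hm)]
        -- Since `x b ^ m` kills `M / Q' m`, the image of `N'` there is a quotient of its image in
        -- `M / Q` reduced modulo `x b ^ m`.
        refine add_le_add_left ?_ 1
        rw [← hfac m, Submodule.map_comp]
        refine supportDim_le_of_surjective_of_smul_eq_zero
          ((Submodule.factor (hQQ' m)).submoduleMap (N'.map Q.mkQ))
          (LinearMap.submoduleMap_surjective _ _) ?_
        rintro ⟨_, ⟨w, -, rfl⟩⟩
        refine Subtype.ext ?_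
        obtain ⟨w, rfl⟩ := Q.mkQ_surjective w
        change Submodule.factor (hQQ' m) (Q.mkQ (x b ^ m • w)) = 0
        rw [← LinearMap.comp_apply, hfac, Submodule.mkQ_apply, Submodule.Quotient.mk_eq_zero]
        refine Submodule.smul_mem_smul (Ideal.subset_span ⟨b, le_refl i, ?_⟩) Submodule.mem_top
        simp [n']
      have hzN' : x b • z ∈ N' := ⟨z, hz, rfl⟩
      -- For `i = 0` the dimension drops to `⊥`, so `N'` lies in every `Q' m`. Otherwise the
      -- induction hypothesis with `k = i - 1` gives `x (i - 1) * x i • z ∈ Q`, and the colon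
      -- relation cancels `x (i - 1)`.
      obtain rfl | ⟨j, rfl⟩ : i = 0 ∨ ∃ j, i = j + 1 := by cases i <;> simp
      · refine hKrull _ fun m hm => ?_
        have h1 : Module.supportDim R (N'.map (Q' m).mkQ) = ⊥ := by
          have := hdim' m hm
          generalize Module.supportDim R (N'.map (Q' m).mkQ) = s at this ⊢
          induction s with
          | bot => rfl
          | coe s =>
            have h2 : s + 1 ≤ 0 := WithBot.coe_le_coe.1 this
            simp at h2
        have h2 := (Module.supportDim_eq_bot_iff_subsingleton R _).1 h1
        have h3 := congrArg Subtype.val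
          (Subsingleton.elim (⟨_, Submodule.mem_map_of_mem hzN'⟩ : N'.map (Q' m).mkQ) 0)
        exact (Submodule.Quotient.mk_eq_zero _).1 h3
      · let c : Fin d := ⟨j, by omega⟩
        refine h.smul_mem_of_mul_smul_mem hx hn hi (a := c) (b := b)
          (Nat.le_succ j) hk (hKrull _ fun m hm => ?_)
        rw [mul_smul]
        refine ih (by omega) (hn' m hm) N' c (Nat.lt_succ_self j) ?_ hzN'
        have := hdim' m hm
        change Module.supportDim R (N'.map (Q' m).mkQ) ≤ (j : ℕ)
        generalize Module.supportDim R (N'.map (Q' m).mkQ) = s at this ⊢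
        induction s with
        | bot => exact bot_le
        | coe s =>
          have h2 : s + 1 ≤ (j : ℕ∞) + 1 := WithBot.coe_le_coe.1 this
          exact WithBot.coe_le_coe.2 ((ENat.add_le_add_iff_right ENat.one_ne_top).1 h2)

theorem IsDDSequence.le_torsionBy_of_supportDim_le {d : ℕ} {x : Fin d → R} (h : IsDDSequence M x)
    (hx : ∀ i, x i ∈ maximalIdeal R) {N : Submodule R M} {k : Fin d}
    (hN : Module.supportDim R N ≤ (k : ℕ)) : N ≤ Submodule.torsionBy R M (x k) := by
  intro z hz
  have := h.smul_mem_of_supportDim_le hx d le_rfl (n := fun _ => 1) (fun _ => one_pos) N k k.2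
    ((supportDim_map_le _ _).trans hN) hz
  rw [powIdeal_length_le_eq_bot, Submodule.bot_smul, Submodule.mem_bot] at this
  exact (Submodule.mem_torsionBy_iff _ _).2 this

/-! ### Maximality properties of the dimension filtration. -/

section

variable {t : ℕ} {D : Fin (t + 1) → Submodule R M}

omit [IsLocalRing R] [IsNoetherianRing R] [Module.Finite R M] in
theorem SatisfiesDimensionCondition.strictMono_supportDim (hD : SatisfiesDimensionCondition D) :
    StrictMono fun i => Module.supportDim R (D i) :=
  Fin.strictMono_iff_lt_succ.2 hD.dim_lt

omit [IsNoetherianRing R] [Module.Finite R M] in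
-- Descend from `D t = M`, using at each stage that the previous term is the largest of smaller
-- dimension.
theorem IsDimensionFiltration.le_of_supportDim_lt (hD : IsDimensionFiltration D) {i : Fin (t + 1)}
    {N : Submodule R M} (hN : ∀ j, i < j → Module.supportDim R N < Module.supportDim R (D j)) :
    N ≤ D i := by
  suffices H : ∀ j, i ≤ j → N ≤ D j from H i le_rfl
  intro j
  induction j using Fin.reverseInduction with
  | last => exact fun _ => hD.last ▸ le_top
  | cast j ih =>
    intro hij
    have hlt : i < j.succ := hij.trans_lt j.castSucc_lt_succ
    exact (hD.isGreatest j).2 ⟨ih hlt.le, hN _ hlt⟩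

theorem IsDimensionFiltration.le_of_supportDim_le_dim (hD : IsDimensionFiltration D)
    {i : Fin (t + 1)} {N : Submodule R M} (hN : Module.supportDim R N ≤ dim R (D i)) :
    N ≤ D i := by
  -- If `D i = 0`, strict growth of dimension forces `i = 0`. As `dim` is then `0` rather than `⊥`,
  -- `N` may be nonzero, and `D 0 = H⁰_𝔪(M)` is needed to conclude.
  rcases subsingleton_or_nontrivial (D i) with hs | hs
  · have hi : i = 0 := by
      by_contra hi
      have := hD.strictMono_supportDim (Fin.pos_iff_ne_zero.2 hi)
      simp only [Module.supportDim_eq_bot_of_subsingleton (R := R) (M := D i), not_lt_bot] at this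
    subst hi
    rw [hD.zero_eq]
    refine le_localCohomologyZero (hN.trans ?_)
    simp [dim, Module.supportDim_eq_bot_of_subsingleton (R := R) (M := D 0)]
  · rw [← supportDim_eq_dim] at hN
    exact hD.le_of_supportDim_lt fun j hj => hN.trans_lt (hD.strictMono_supportDim hj)

theorem IsDimensionFiltration.dim_lt_dim (hD : IsDimensionFiltration D) (i : Fin t) :
    dim R (D i.castSucc) < dim R M := by
  by_contra! hle
  have h1 : (⊤ : Submodule R M) ≤ D i.castSucc := by
    refine hD.le_of_supportDim_le_dim ((supportDim_submodule_le _).trans ?_)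
    exact supportDim_le_dim.trans (by exact_mod_cast hle)
  exact ((supportDim_mono (le_top.trans h1)).trans_lt (hD.dim_lt i)).false

end

end

end DDSeq

theorem mainTheorem8 {R : Type*} [CommRing R] [IsLocalRing R] [IsNoetherianRing R]
    {M : Type*} [AddCommGroup M] [Module R M] [Module.Finite R M]
    {d t : ℕ} (x : Fin d → R) (D : Fin (t + 1) → Submodule R M)
    (hx : DDSeq.IsSystemOfParameters M x)
    (hD : DDSeq.IsDimensionFiltration D)
    (hdd : DDSeq.IsDDSequence M x) :
    (∀ i : Fin t, ∃ h : DDSeq.dim R (D i.castSucc) < d,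
      D i.castSucc = Submodule.torsionBy R M (x ⟨DDSeq.dim R (D i.castSucc), h⟩)) ∧
    DDSeq.IsGoodSystemOfParameters D x := by
  have key : ∀ i : Fin t, ∃ h : DDSeq.dim R (D i.castSucc) < d,
      D i.castSucc = Submodule.torsionBy R M (x ⟨DDSeq.dim R (D i.castSucc), h⟩) := by
    intro i
    have h : DDSeq.dim R (D i.castSucc) < d := (hD.dim_lt_dim i).trans_eq hx.dim_eq
    refine ⟨h, le_antisymm ?_ ?_⟩
    · exact hdd.le_torsionBy_of_supportDim_le hx.mem_maximalIdeal DDSeq.supportDim_le_dim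
    · exact hD.le_of_supportDim_le_dim (hdd.supportDim_torsionBy_le hx ⟨_, h⟩)
  refine ⟨key, { hx with inf_eq_bot := fun i => ?_ }⟩
  obtain ⟨h, hi⟩ := key i
  rw [eq_bot_iff]
  rintro z ⟨hz, hz'⟩
  rw [SetLike.mem_coe, hi] at hz
  exact hdd.eq_zero_of_smul_eq_zero_of_mem hx.mem_maximalIdeal (a := ⟨_, h⟩)
    ((Submodule.mem_torsionBy_iff _ _).1 hz) hz'
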